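/- Let $N\ge 1$ be a fixed integer, let $A_1,\dots,A_N$ be almost surely positive random variables on a common probability space, and let $X_0$ be a real random variable with law $F_0$ and characteristic function $\phi_0$. For characteristic functions $\phi_1,\dots,\phi_N$ put $$\widehat Q(\phi_1,\dots,\phi_N)(\xi)=\mathbb E\bigl[\phi_1(A_1\xi)\cdots\phi_N(A_N\xi)\bigr],\qquad \xi\in\mathbb R .$$ Consider the Cauchy problem $$\partial_t\phi(t,\xi)+\phi(t,\xi)=\widehat Q(\phi(t,\cdot),\dots,\phi(t,\cdot))(\xi)\quad(t>0),\qquad \phi(0,\xi)=\phi_0(\xi),\qquad \xi\in\mathbb R,$$ where a solution is a function $\phi:[0,\infty)\times\mathbb R\to\mathbb C$ such that $\phi(t,\cdot)$ is the characteristic function of a probability measure on $\mathbb R$ for every $t\ge0$, $t\mapsto\phi(t,\xi)$ is continuous on $[0,\infty)$ and differentiable on $(0,\infty)$ for every $\xi$, and the two equations hold pointwise. Continuous-time branching random walk: a single initial particle is located at $0$; every particle $v$ lives for an exponential time with parameter $1$, then dies and is replaced by $N$ children, displaced from the position of $v$ by the components of a random vector $(Z_1(v),\dots,Z_N(v))$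 distributed as $(\log A_1,\dots,\log A_N)$; all lifetimes and all displacement vectors are independent. Let $\mathcal Y_t$ be the number of particles present at time $t$ (a Yule process), let $z_{1,t},\dots,z_{\mathcal Y_t,t}$ be their locations, listed in any measurable way, and let $\mathcal Z_t=\sum_{k=1}^{\mathcal Y_t}\delta_{z_{k,t}}$. The associated smoothing transform $\mathcal L_t$ maps a probability law $\nu$ on $\mathbb R$ to the law of $\sum_{k=1}^{\mathcal Y_t}e^{z_{k,t}}U_k$, where $U_1,U_2,\dots$ are i.i.d. with law $\nu$ and independent of the walk and of the listing of its particles. Then the Cauchy problem has a unique solution $\phi$. Moreover, for every such branching random walk $(\mathcal Z_t)_{t\ge0}$, and every i.i.d. sequence $X_1,X_2,\dots$ with law $F_0$ that is defined on the same probability space and independent of the walk and of the listing of its particles, $$\phi(t,\xi)=\mathbb E\exp\Bigl(i\xi\sum_{k=1}^{\mathcal Y_t}e^{z_{k,t}}X_k\Bigr),\qquad t\ge0,\ \xi\in\mathbb R;$$ that is, $\phi(t,\cdot)$ is the characteristic function of $\mathcal L_t(F_0)$. -/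

import Mathlib

namespace KineticBRW

open MeasureTheory ProbabilityTheory

noncomputable section

/-! ### The Cauchy problem -/

/-- The smoothing transform `Q̂(φ₁, …, φ_N)(ξ) = 𝔼 (φ₁(A₁ ξ) ⋯ φ_N(A_N ξ))`. -/
def smoothingOp {N : ℕ} {Ω : Type*} [MeasurableSpace Ω] (P : Measure Ω) (A : Fin N → Ω → ℝ)
    (φ : Fin N → ℝ → ℂ) (ξ : ℝ) : ℂ :=
  ∫ ω, ∏ i, φ i (A i ω * ξ) ∂P

/-- `φ` is a solution of `∂ₜ φ + φ = Q̂(φ, …, φ)` for `t > 0`, `φ(0, ·) = 𝔼 exp(i · X₀)`: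
at each time `t ≥ 0` it is the characteristic function of a probability measure `ρ_t`, it is
continuous in time up to `t = 0`, and the equation holds pointwise, in the classical sense.
Values at negative times are irrelevant. -/
structure IsSolution {N : ℕ} {Ω : Type*} [MeasurableSpace Ω] (P : Measure Ω)
    (A : Fin N → Ω → ℝ) (X₀ : Ω → ℝ) (φ : ℝ → ℝ → ℂ) : Prop where
  charFun_of_prob : ∀ t : ℝ, 0 ≤ t →
    ∃ ρ : Measure ℝ, IsProbabilityMeasure ρ ∧ ∀ ξ, φ t ξ = charFun ρ ξ
  initial : ∀ ξ, φ 0 ξ = charFun (P.map X₀) ξ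
  continuous_time : ∀ ξ, ContinuousOn (fun t => φ t ξ) (Set.Ici 0)
  equation : ∀ t : ℝ, 0 < t → ∀ ξ : ℝ, ∃ d : ℂ, HasDerivAt (fun s => φ s ξ) d t ∧
    d + φ t ξ = smoothingOp P A (fun _ => φ t) ξ

/-! ### The continuous-time branching random walk

Particles are words over `Fin N`: the initial particle is `[]`, and `i :: v` is the `i`-th child
of `v`. The particle `v` lives for the time `τ v`, then dies and is replaced by its `N` children,
the `i`-th one displaced by `D v i` from the position of `v`. -/

/-- Time at which the particle `v` is born. -/
def birth {N : ℕ} (τ : List (Fin N) → ℝ) : List (Fin N) → ℝ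
  | [] => 0
  | _ :: v => birth τ v + τ v

/-- Position of the particle `v`. -/
def position {N : ℕ} (D : List (Fin N) → Fin N → ℝ) : List (Fin N) → ℝ
  | [] => 0
  | i :: v => position D v + D v i

/-- The particles present at time `t`. -/
def alive {N : ℕ} (τ : List (Fin N) → ℝ) (t : ℝ) : Set (List (Fin N)) :=
  {v | birth τ v ≤ t ∧ t < birth τ v + τ v}

/-- The Yule process `𝒴_t`: the number of particles present at time `t`. -/
def yule {N : ℕ} (τ : List (Fin N) → ℝ) (t : ℝ) : ℕ := (alive τ t).ncard

/-- The branching random walk `𝒵_t = ∑ δ_{position}`, the sum over the particles present at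
time `t`. -/
def walk {N : ℕ} (τ : List (Fin N) → ℝ) (D : List (Fin N) → Fin N → ℝ) (t : ℝ) : Measure ℝ :=
  Measure.sum fun v : alive τ t => Measure.dirac (position D v)

/-- `τ`, `D` are the lifetimes and displacements of a branching random walk whose displacement
vectors have law `κ`: the pairs `(τ v, D v)` are i.i.d. over all particles `v`, the lifetime is
exponential with parameter `1`, and independent of the displacement vector. -/
structure IsBranchingRandomWalk {N : ℕ} {Ω : Type*} [MeasurableSpace Ω] (P : Measure Ω)
    (κ : Measure (Fin N → ℝ)) (τ : List (Fin N) → Ω → ℝ)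
    (D : List (Fin N) → Ω → Fin N → ℝ) : Prop where
  measurable_lifetime : ∀ v, Measurable (τ v)
  measurable_displacement : ∀ v, Measurable (D v)
  law : ∀ v, P.map (fun ω => (τ v ω, D v ω)) = (expMeasure 1).prod κ
  indep : iIndepFun (fun v ω => (τ v ω, D v ω)) P

/-- `z t 0, z t 1, …, z t (𝒴_t - 1)` are the locations of the particles present at time `t`,
listed in an arbitrary measurable way: `𝒵_t = ∑_{k < 𝒴_t} δ_{z t k}` almost surely where only
finitely many particles are present. -/
structure IsLocationList {N : ℕ} {Ω : Type*} [MeasurableSpace Ω] (P : Measure Ω)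
    (τ : List (Fin N) → Ω → ℝ) (D : List (Fin N) → Ω → Fin N → ℝ)
    (z : ℝ → ℕ → Ω → ℝ) : Prop where
  measurable_location : ∀ t k, Measurable (z t k)
  walk_eq : ∀ t : ℝ, 0 ≤ t → ∀ᵐ ω ∂P, (alive (fun v => τ v ω) t).Finite →
    walk (fun v => τ v ω) (fun v => D v ω) t =
      ∑ k ∈ Finset.range (yule (fun v => τ v ω) t), Measure.dirac (z t k ω)

/-- The sum `∑_{k < 𝒴_t} exp(z_{k,t}) x_k`. -/
def weightedSum {N : ℕ} {Ω : Type*} (τ : List (Fin N) → Ω → ℝ) (z : ℝ → ℕ → Ω → ℝ) (t : ℝ)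
    (ω : Ω) (x : ℕ → ℝ) : ℝ :=
  ∑ k ∈ Finset.range (yule (fun v => τ v ω) t), Real.exp (z t k ω) * x k

/-- The smoothing transform `ℒ_t` associated with the branching random walk, acting on probability
distributions on `ℝ`: `ℒ_t(ν)` is the law of `∑_{k < 𝒴_t} exp(z_{k,t}) U_k`, where the `U_k` are
i.i.d. with law `ν` and independent of the walk (realized on a product space). -/
def smoothingTransform {N : ℕ} {Ω : Type*} [MeasurableSpace Ω] (P : Measure Ω)
    (τ : List (Fin N) → Ω → ℝ) (z : ℝ → ℕ → Ω → ℝ) (t : ℝ) (ν : Measure ℝ)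
    [IsProbabilityMeasure ν] : Measure ℝ :=
  (P.prod (Measure.infinitePi fun _ : ℕ => ν)).map fun p => weightedSum τ z t p.1 p.2

/-- `X 0, X 1, …` are i.i.d. with law `ν`, and independent at each time `t ≥ 0` of the
configuration `(𝒴_t, (z_{k,t})_k)` of the branching random walk. -/
structure IsInitialSample {N : ℕ} {Ω : Type*} [MeasurableSpace Ω] (P : Measure Ω)
    (ν : Measure ℝ) (τ : List (Fin N) → Ω → ℝ) (z : ℝ → ℕ → Ω → ℝ) (X : ℕ → Ω → ℝ) : Prop where
  measurable_sample : ∀ k, Measurable (X k)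
  law : ∀ k, P.map (X k) = ν
  indep : iIndepFun X P
  indep_walk : ∀ t : ℝ, 0 ≤ t →
    IndepFun (fun ω => (yule (fun v => τ v ω) t, fun k => z t k ω)) (fun ω k => X k ω) P

end

end KineticBRW

namespace KineticBRW

open MeasureTheory ProbabilityTheory Filter Topology

noncomputable section

/-! ### Words and the decomposition of the tree at the root -/

/-- The words over `Fin N` of length less than `n`. -/
def words (N : ℕ) : ℕ → Finset (List (Fin N))
  | 0 => ∅
  | n + 1 => insert [] ((words N n ×ˢ Finset.univ).image fun p => p.1 ++ [p.2])

lemma mem_words {N n : ℕ} {v : List (Fin N)} : v ∈ words N n ↔ v.length < n := by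
  induction n generalizing v with
  | zero => simp [words]
  | succ n ih =>
    rcases List.eq_nil_or_concat' v with rfl | ⟨w, i, rfl⟩
    · simp [words]
    · simp [words, ih]

lemma exists_subset_words {N : ℕ} {s : Set (List (Fin N))} (hs : s.Finite) :
    ∃ n, ∀ m, n ≤ m → ∀ v ∈ s, v ∈ words N m := by
  obtain ⟨b, hb⟩ := (hs.image List.length).bddAbove
  refine ⟨b + 1, fun m hm v hv => mem_words.2 ?_⟩
  have := hb (Set.mem_image_of_mem _ hv)
  omega

@[to_additive]
lemma prod_words_succ {N : ℕ} {M : Type*} [CommMonoid M] (n : ℕ) (f : List (Fin N) → M) :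
    ∏ v ∈ words N (n + 1), f v = f [] * ∏ i, ∏ v ∈ words N n, f (v ++ [i]) := by
  rw [words, Finset.prod_insert (by simp), Finset.prod_image (by
    rintro ⟨v, i⟩ _ ⟨w, j⟩ _ h
    simpa using h), Finset.prod_product_right]

lemma birth_append {N : ℕ} (τ : List (Fin N) → ℝ) (v : List (Fin N)) (i : Fin N) :
    birth τ (v ++ [i]) = τ [] + birth (fun w => τ (w ++ [i])) v := by
  induction v with
  | nil => simp [birth]
  | cons j v ih =>
    simp only [List.cons_append, birth, ih]
    ring

lemma position_append {N : ℕ} (D : List (Fin N) → Fin N → ℝ) (v : List (Fin N)) (i : Fin N) :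
    position D (v ++ [i]) = D [] i + position (fun w => D (w ++ [i])) v := by
  induction v with
  | nil => simp [position]
  | cons j v ih =>
    simp only [List.cons_append, position, ih]
    ring

lemma birth_nonneg {N : ℕ} {τ : List (Fin N) → ℝ} (hτ : ∀ v, 0 ≤ τ v) (v : List (Fin N)) :
    0 ≤ birth τ v := by
  induction v with
  | nil => simp [birth]
  | cons j v ih => simpa [birth] using add_nonneg ih (hτ v)

lemma append_mem_alive {N : ℕ} {τ : List (Fin N) → ℝ} {t : ℝ} {v : List (Fin N)} {i : Fin N} :
    v ++ [i] ∈ alive τ t ↔ v ∈ alive (fun w => τ (w ++ [i])) (t - τ []) := by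
  simp only [alive, Set.mem_ofPred_eq, birth_append]
  constructor <;> rintro ⟨h, h'⟩ <;> constructor <;> linarith

/-- The family of marks with mark `r` at the root, and with the family of marks `y i` on the
subtree of the `i`-th child of the root. -/
def graft {N : ℕ} {E : Type*} (p : E × (Fin N → List (Fin N) → E)) (v : List (Fin N)) : E :=
  if h : v = [] then p.1 else p.2 (v.getLast h) v.dropLast

@[simp]
lemma graft_nil {N : ℕ} {E : Type*} (p : E × (Fin N → List (Fin N) → E)) :
    graft p [] = p.1 := by simp [graft]

@[simp]
lemma graft_append {N : ℕ} {E : Type*} (p : E × (Fin N → List (Fin N) → E)) (v : List (Fin N))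
    (i : Fin N) : graft p (v ++ [i]) = p.2 i v := by simp [graft]

lemma measurable_graft {N : ℕ} {E : Type*} [MeasurableSpace E] :
    Measurable (graft : E × (Fin N → List (Fin N) → E) → List (Fin N) → E) := by
  refine measurable_pi_lambda _ fun v => ?_
  rcases List.eq_nil_or_concat' v with rfl | ⟨w, i, rfl⟩
  · simpa using measurable_fst
  · simp only [graft_append]
    fun_prop

/-- Grafting independent i.i.d. families onto an independent root gives an i.i.d. family. -/
lemma map_graft {N : ℕ} {E : Type*} [MeasurableSpace E] (ρ : Measure E) [IsProbabilityMeasure ρ] :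
    (ρ.prod (Measure.pi fun _ : Fin N => Measure.infinitePi fun _ : List (Fin N) => ρ)).map graft =
      Measure.infinitePi fun _ : List (Fin N) => ρ := by
  classical
  refine Measure.eq_infinitePi _ fun s t ht => ?_
  obtain ⟨n, hn⟩ := exists_subset_words s.finite_toSet
  have hs : s ⊆ words N (n + 1) := fun v hv => hn _ (by omega) v hv
  set u : List (Fin N) → Set E := fun v => if v ∈ s then t v else Set.univ with hu
  have hum : ∀ v, MeasurableSet (u v) := fun v => by
    simp only [hu]; split_ifs
    · exact ht v
    · exact .univ
  have hbox : (s : Set (List (Fin N))).pi t = ((words N (n + 1) : Finset _) : Set _).pi u := by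
    ext x
    simp only [Set.mem_pi, Finset.mem_coe, hu]
    constructor
    · intro h v _
      split_ifs with hv
      · exact h v hv
      · trivial
    · intro h v hv
      simpa [hv] using h v (hs hv)
  have hprod : ∏ v ∈ s, ρ (t v) = ∏ v ∈ words N (n + 1), ρ (u v) := by
    rw [← Finset.prod_subset hs]
    · exact Finset.prod_congr rfl fun v hv => by simp [hu, hv]
    · intro v _ hv
      simp [hu, hv]
  have hpre : graft ⁻¹' ((words N (n + 1) : Finset _) : Set _).pi u =
      u [] ×ˢ Set.univ.pi fun i => ((words N n : Finset _) : Set (List (Fin N))).pi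
        fun w => u (w ++ [i]) := by
    ext p
    simp only [Set.mem_preimage, Set.mem_pi, Set.mem_prod, Finset.mem_coe, Set.mem_univ,
      true_implies]
    constructor
    · intro h
      refine ⟨by simpa using h [] (by simp [mem_words]), fun i w hw => ?_⟩
      simpa using h (w ++ [i]) (by simpa [mem_words] using hw)
    · rintro ⟨h, h'⟩ v hv
      rcases List.eq_nil_or_concat' v with rfl | ⟨w, i, rfl⟩
      · simpa using h
      · simpa using h' i w (by simpa [mem_words] using hv)
  rw [hbox, hprod, Measure.map_apply measurable_graft
    (.pi (Finset.countable_toSet _) fun v _ => hum v), hpre, Measure.prod_prod, Measure.pi_pi,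
    prod_words_succ]
  congr 1
  exact Finset.prod_congr rfl fun i _ => Measure.infinitePi_pi _ fun w _ => hum _

/-! ### The exponential law -/

instance isProbabilityMeasure_expMeasure_one : IsProbabilityMeasure (expMeasure 1) :=
  isProbabilityMeasure_expMeasure one_pos

lemma expMeasure_eq_withDensity (r : ℝ) :
    expMeasure r = volume.withDensity (exponentialPDF r) := rfl

lemma measurable_exponentialPDF (r : ℝ) : Measurable (exponentialPDF r) :=
  (measurable_exponentialPDFReal r).ennreal_ofReal

lemma ae_nonneg_expMeasure : ∀ᵐ s ∂expMeasure 1, 0 ≤ s := by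
  rw [expMeasure_eq_withDensity, ae_withDensity_iff (measurable_exponentialPDF 1)]
  refine ae_of_all _ fun s hs => ?_
  by_contra h
  exact hs (exponentialPDF_of_neg (not_le.1 h))

lemma lintegral_exp_neg_mul_expMeasure {a : ℝ} (ha : 0 ≤ a) :
    ∫⁻ s, ENNReal.ofReal (Real.exp (-(a * s))) ∂expMeasure 1 = ENNReal.ofReal (1 + a)⁻¹ := by
  have h1 : 0 < 1 + a := by linarith
  rw [expMeasure_eq_withDensity, lintegral_withDensity_eq_lintegral_mul _
    (measurable_exponentialPDF 1) (by fun_prop)]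
  have : ∀ s : ℝ, (exponentialPDF 1 * fun s => ENNReal.ofReal (Real.exp (-(a * s)))) s =
      ENNReal.ofReal (1 + a)⁻¹ * exponentialPDF (1 + a) s := by
    intro s
    rw [Pi.mul_apply, exponentialPDF_eq, exponentialPDF_eq]
    split_ifs with hs
    · rw [← ENNReal.ofReal_mul (by positivity), ← ENNReal.ofReal_mul (by positivity)]
      congr 1
      rw [one_mul, one_mul, ← Real.exp_add, ← mul_assoc, inv_mul_cancel₀ h1.ne', one_mul]
      congr 1
      ring
    · simp
  simp_rw [this]
  rw [lintegral_const_mul _ (measurable_exponentialPDF _), lintegral_exponentialPDF_eq_one h1,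
    mul_one]

lemma integral_expMeasure {E : Type*} [NormedAddCommGroup E] [NormedSpace ℝ E] (f : ℝ → E) :
    ∫ s, f s ∂expMeasure 1 = ∫ s in Set.Ioi 0, Real.exp (-s) • f s := by
  rw [expMeasure_eq_withDensity, integral_withDensity_eq_integral_toReal_smul
    (measurable_exponentialPDF 1) (ae_of_all _ fun s => by simp [exponentialPDF]),
    ← integral_Ici_eq_integral_Ioi, ← integral_indicator measurableSet_Ici]
  refine integral_congr_ae (ae_of_all _ fun s => ?_)
  by_cases hs : 0 ≤ s
  · simp [exponentialPDF_eq, hs, ENNReal.toReal_ofReal (Real.exp_pos _).le]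
  · simp [exponentialPDF_eq, hs]

/-! ### The law of the branching random walk -/

/-- The law of the i.i.d. family of lifetimes and displacements. -/
def treeMeasure {N : ℕ} (κ : Measure (Fin N → ℝ)) [IsProbabilityMeasure κ] :
    Measure (List (Fin N) → ℝ × (Fin N → ℝ)) :=
  Measure.infinitePi fun _ => (expMeasure 1).prod κ

instance isProbabilityMeasure_treeMeasure {N : ℕ} (κ : Measure (Fin N → ℝ))
    [IsProbabilityMeasure κ] : IsProbabilityMeasure (treeMeasure κ) := by
  unfold treeMeasure; infer_instance

lemma map_graft_treeMeasure {N : ℕ} (κ : Measure (Fin N → ℝ)) [IsProbabilityMeasure κ] :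
    (((expMeasure 1).prod κ).prod (Measure.pi fun _ : Fin N => treeMeasure κ)).map graft =
      treeMeasure κ := map_graft _

lemma IsBranchingRandomWalk.map_eq {N : ℕ} {Ω : Type*} [MeasurableSpace Ω] {P : Measure Ω}
    {κ : Measure (Fin N → ℝ)} [IsProbabilityMeasure κ] {τ : List (Fin N) → Ω → ℝ}
    {D : List (Fin N) → Ω → Fin N → ℝ} (h : IsBranchingRandomWalk P κ τ D) :
    P.map (fun ω v => (τ v ω, D v ω)) = treeMeasure κ := by
  rw [h.indep.map_fun_eq_infinitePi_map fun v =>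
    (h.measurable_lifetime v).prodMk (h.measurable_displacement v), treeMeasure]
  simp_rw [h.law]

/-- The lifetimes recorded by a family of marks. -/
def lifetimes {N : ℕ} (x : List (Fin N) → ℝ × (Fin N → ℝ)) (v : List (Fin N)) : ℝ := (x v).1

/-- The displacements recorded by a family of marks. -/
def displacements {N : ℕ} (x : List (Fin N) → ℝ × (Fin N → ℝ)) (v : List (Fin N)) : Fin N → ℝ :=
  (x v).2

lemma measurable_birth {N : ℕ} (v : List (Fin N)) :
    Measurable fun x : List (Fin N) → ℝ × (Fin N → ℝ) => birth (lifetimes x) v := by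
  induction v with
  | nil => simp [birth]
  | cons i v ih =>
    simp only [birth, lifetimes] at ih ⊢
    fun_prop

lemma measurable_position {N : ℕ} (v : List (Fin N)) :
    Measurable fun x : List (Fin N) → ℝ × (Fin N → ℝ) => position (displacements x) v := by
  induction v with
  | nil => simp [position]
  | cons i v ih =>
    simp only [position, displacements] at ih ⊢
    fun_prop

lemma measurableSet_mem_alive {N : ℕ} (v : List (Fin N)) :
    MeasurableSet {p : ℝ × (List (Fin N) → ℝ × (Fin N → ℝ)) | v ∈ alive (lifetimes p.2) p.1} := by
  have hb := (measurable_birth v).comp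
    (measurable_snd : Measurable fun p : ℝ × (List (Fin N) → ℝ × (Fin N → ℝ)) => p.2)
  have hl : Measurable fun p : ℝ × (List (Fin N) → ℝ × (Fin N → ℝ)) => lifetimes p.2 v := by
    unfold lifetimes; fun_prop
  exact (measurableSet_le hb measurable_fst).inter (measurableSet_lt measurable_fst (hb.add hl))

lemma ae_lifetimes_nonneg {N : ℕ} (κ : Measure (Fin N → ℝ)) [IsProbabilityMeasure κ] :
    ∀ᵐ x ∂treeMeasure κ, ∀ v, 0 ≤ lifetimes x v := by
  rw [ae_all_iff]
  intro v
  have h1 : ∀ᵐ r ∂(expMeasure 1).prod κ, 0 ≤ r.1 :=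
    Measure.quasiMeasurePreserving_fst.ae ae_nonneg_expMeasure
  exact (measurePreserving_eval_infinitePi
    (fun _ : List (Fin N) => (expMeasure 1).prod κ) v).quasiMeasurePreserving.ae h1

lemma birth_graft_append {N : ℕ} (p : (ℝ × (Fin N → ℝ)) × (Fin N → List (Fin N) → ℝ × (Fin N → ℝ)))
    (v : List (Fin N)) (i : Fin N) :
    birth (lifetimes (graft p)) (v ++ [i]) = p.1.1 + birth (lifetimes (p.2 i)) v := by
  rw [birth_append]
  simp only [lifetimes, graft_nil, graft_append]
  rfl

lemma lintegral_sum_exp_neg_birth_le {N : ℕ} (κ : Measure (Fin N → ℝ)) [IsProbabilityMeasure κ]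
    (n : ℕ) :
    ∫⁻ x, ∑ v ∈ words N n, ENNReal.ofReal (Real.exp (-(N * birth (lifetimes x) v)))
      ∂treeMeasure κ ≤ N + 1 := by
  set h : ℕ → (List (Fin N) → ℝ × (Fin N → ℝ)) → ENNReal := fun n x =>
    ∑ v ∈ words N n, ENNReal.ofReal (Real.exp (-(N * birth (lifetimes x) v))) with hh
  have hm : ∀ n, Measurable (h n) := fun n => by
    have := fun v => measurable_birth (N := N) v
    simp only [hh]
    fun_prop
  induction n with
  | zero => simp [words]
  | succ n ih =>
    have key : ∀ p : (ℝ × (Fin N → ℝ)) × (Fin N → List (Fin N) → ℝ × (Fin N → ℝ)),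
        h (n + 1) (graft p) =
          1 + ∑ i, ENNReal.ofReal (Real.exp (-(N * p.1.1))) * h n (p.2 i) := by
      intro p
      simp only [hh, sum_words_succ, birth_graft_append, Finset.mul_sum]
      congr 1
      · simp [birth]
      · refine Finset.sum_congr rfl fun i _ => Finset.sum_congr rfl fun v _ => ?_
        rw [← ENNReal.ofReal_mul (Real.exp_pos _).le, ← Real.exp_add]
        ring_nf
    have hmul : ∀ i : Fin N, ∫⁻ p : (ℝ × (Fin N → ℝ)) × (Fin N → List (Fin N) → ℝ × (Fin N → ℝ)),
        ENNReal.ofReal (Real.exp (-(N * p.1.1))) * h n (p.2 i)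
          ∂((expMeasure 1).prod κ).prod (Measure.pi fun _ : Fin N => treeMeasure κ) =
        ENNReal.ofReal (1 + N)⁻¹ * ∫⁻ x, h n x ∂treeMeasure κ := by
      intro i
      rw [lintegral_prod_mul
        (f := fun r : ℝ × (Fin N → ℝ) => ENNReal.ofReal (Real.exp (-(N * r.1))))
        (g := fun y : Fin N → List (Fin N) → ℝ × (Fin N → ℝ) => h n (y i)) (by fun_prop)
        ((hm n).comp (measurable_pi_apply i)).aemeasurable]
      congr 1
      · rw [← lintegral_exp_neg_mul_expMeasure (Nat.cast_nonneg N)]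
        exact (measurePreserving_fst (μ := expMeasure 1) (ν := κ)).lintegral_comp
          (f := fun s => ENNReal.ofReal (Real.exp (-(N * s)))) (by fun_prop)
      · exact (measurePreserving_eval (fun _ : Fin N => treeMeasure κ) i).lintegral_comp (hm n)
    calc ∫⁻ x, h (n + 1) x ∂treeMeasure κ
        = ∫⁻ p, h (n + 1) (graft p)
            ∂((expMeasure 1).prod κ).prod (Measure.pi fun _ : Fin N => treeMeasure κ) := by
          rw [← lintegral_map (hm _) measurable_graft, map_graft_treeMeasure]
      _ = 1 + N * (ENNReal.ofReal (1 + N)⁻¹ * ∫⁻ x, h n x ∂treeMeasure κ) := by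
          simp_rw [key]
          rw [lintegral_add_left measurable_const, lintegral_finsetSum]
          · simp [hmul]
          · intro i _
            have := hm n
            fun_prop
      _ ≤ 1 + N * (ENNReal.ofReal (1 + N)⁻¹ * (N + 1)) := by gcongr
      _ = N + 1 := by
          have : ENNReal.ofReal (1 + N)⁻¹ * ((N : ENNReal) + 1) = 1 := by
            have h1 : ((N : ENNReal) + 1) = ENNReal.ofReal (1 + N) := by
              rw [ENNReal.ofReal_add zero_le_one (Nat.cast_nonneg N)]
              simp [add_comm]
            rw [h1, ← ENNReal.ofReal_mul (by positivity), inv_mul_cancel₀ (by positivity)]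
            simp
          rw [this, mul_one, add_comm]

/-- The branching random walk does not explode. -/
lemma ae_finite_alive {N : ℕ} (κ : Measure (Fin N → ℝ)) [IsProbabilityMeasure κ] :
    ∀ᵐ x ∂treeMeasure κ, ∀ t, (alive (lifetimes x) t).Finite := by
  set g : List (Fin N) → (List (Fin N) → ℝ × (Fin N → ℝ)) → ENNReal := fun v x =>
    ENNReal.ofReal (Real.exp (-(N * birth (lifetimes x) v))) with hg
  have hgm : ∀ v, Measurable (g v) := fun v => by
    have := measurable_birth (N := N) v
    simp only [hg]
    fun_prop
  have hsum : ∑' v, ∫⁻ x, g v x ∂treeMeasure κ ≤ N + 1 := by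
    rw [ENNReal.tsum_eq_iSup_sum]
    refine iSup_le fun s => ?_
    obtain ⟨n, hn⟩ := exists_subset_words s.finite_toSet
    calc ∑ v ∈ s, ∫⁻ x, g v x ∂treeMeasure κ
        ≤ ∑ v ∈ words N n, ∫⁻ x, g v x ∂treeMeasure κ :=
          Finset.sum_le_sum_of_subset fun v hv => hn n le_rfl v hv
      _ = ∫⁻ x, ∑ v ∈ words N n, g v x ∂treeMeasure κ :=
          (lintegral_finsetSum _ fun v _ => hgm v).symm
      _ ≤ N + 1 := lintegral_sum_exp_neg_birth_le κ n
  rw [← lintegral_tsum fun v => (hgm v).aemeasurable] at hsum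
  have hfin : ∀ᵐ x ∂treeMeasure κ, ∑' v, g v x < ⊤ :=
    ae_lt_top (Measurable.tsum hgm) (ne_top_of_le_ne_top (by simp) hsum)
  filter_upwards [hfin] with x hx t
  refine (ENNReal.finite_const_le_of_tsum_ne_top hx.ne
    (ε := ENNReal.ofReal (Real.exp (-(N * t)))) (by simp [Real.exp_pos])).subset fun v hv => ?_
  have hb : birth (lifetimes x) v ≤ t := hv.1
  simp only [hg, Set.mem_ofPred_eq]
  gcongr

/-! ### Products over the particles present at a given time -/

/-- The product of `g (exp(position) ξ)` over the particles present at time `t`. -/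
def leafProduct {N : ℕ} (g : ℝ → ℂ) (τ : List (Fin N) → ℝ) (D : List (Fin N) → Fin N → ℝ)
    (t ξ : ℝ) : ℂ :=
  ∏ᶠ v ∈ alive τ t, g (Real.exp (position D v) * ξ)

open Classical in
/-- The product of `g (exp(position) ξ)` over the particles of generation less than `n` that are
present at time `t`. -/
def leafProductTrunc {N : ℕ} (g : ℝ → ℂ) (n : ℕ) (τ : List (Fin N) → ℝ)
    (D : List (Fin N) → Fin N → ℝ) (t ξ : ℝ) : ℂ :=
  ∏ v ∈ words N n, if v ∈ alive τ t then g (Real.exp (position D v) * ξ) else 1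

lemma leafProduct_eq_prod {N : ℕ} (g : ℝ → ℂ) {τ : List (Fin N) → ℝ}
    (D : List (Fin N) → Fin N → ℝ) {t : ℝ} (ξ : ℝ) (h : (alive τ t).Finite) :
    leafProduct g τ D t ξ = ∏ v ∈ h.toFinset, g (Real.exp (position D v) * ξ) :=
  finprod_mem_eq_finite_toFinset_prod _ h

lemma eventually_leafProductTrunc_eq {N : ℕ} (g : ℝ → ℂ) {τ : List (Fin N) → ℝ}
    (D : List (Fin N) → Fin N → ℝ) {t : ℝ} (ξ : ℝ) (h : (alive τ t).Finite) :
    ∀ᶠ n in atTop, leafProductTrunc g n τ D t ξ = leafProduct g τ D t ξ := by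
  classical
  obtain ⟨n, hn⟩ := exists_subset_words h
  filter_upwards [eventually_ge_atTop n] with m hm
  rw [leafProduct_eq_prod g D ξ h, leafProductTrunc, ← Finset.prod_filter]
  refine Finset.prod_congr ?_ fun _ _ => rfl
  ext v
  simpa using hn m hm v

lemma norm_leafProductTrunc_le {N : ℕ} {g : ℝ → ℂ} (hg : ∀ ξ, ‖g ξ‖ ≤ 1) (n : ℕ)
    (τ : List (Fin N) → ℝ) (D : List (Fin N) → Fin N → ℝ) (t ξ : ℝ) :
    ‖leafProductTrunc g n τ D t ξ‖ ≤ 1 := by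
  rw [leafProductTrunc, norm_prod]
  refine Finset.prod_le_one (fun _ _ => norm_nonneg _) fun v _ => ?_
  split_ifs
  · exact hg _
  · simp

lemma measurable_leafProductTrunc {N : ℕ} {g : ℝ → ℂ} (hg : Measurable g) (n : ℕ) :
    Measurable fun p : (ℝ × ℝ) × (List (Fin N) → ℝ × (Fin N → ℝ)) =>
      leafProductTrunc g n (lifetimes p.2) (displacements p.2) p.1.1 p.1.2 := by
  unfold leafProductTrunc
  refine Finset.measurable_prod _ fun v _ => Measurable.ite ?_ ?_ measurable_const
  · exact (show Measurable fun p : (ℝ × ℝ) × (List (Fin N) → ℝ × (Fin N → ℝ)) => (p.1.1, p.2) by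
      fun_prop) (measurableSet_mem_alive v)
  · have hp : Measurable fun p : (ℝ × ℝ) × (List (Fin N) → ℝ × (Fin N → ℝ)) =>
        position (displacements p.2) v := (measurable_position v).comp measurable_snd
    exact hg.comp (hp.exp.mul (by fun_prop))

lemma leafProductTrunc_succ {N : ℕ} (g : ℝ → ℂ) (n : ℕ) {τ : List (Fin N) → ℝ}
    (hτ : ∀ v, 0 ≤ τ v) (D : List (Fin N) → Fin N → ℝ) {t : ℝ} (ht : 0 ≤ t) (ξ : ℝ) :
    leafProductTrunc g (n + 1) τ D t ξ = if t < τ [] then g ξ else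
      ∏ i, leafProductTrunc g n (fun v => τ (v ++ [i])) (fun v => D (v ++ [i])) (t - τ [])
        (Real.exp (D [] i) * ξ) := by
  classical
  simp only [leafProductTrunc]
  rw [prod_words_succ]
  have h0 : [] ∈ alive τ t ↔ t < τ [] := by simp [alive, birth, ht]
  simp only [append_mem_alive, position_append, Real.exp_add, h0]
  split_ifs with h
  · have : ∀ (i : Fin N) (v : List (Fin N)), v ∉ alive (fun w => τ (w ++ [i])) (t - τ []) := by
      intro i v hv
      have := birth_nonneg (fun w => hτ (w ++ [i])) v
      have := hv.1
      linarith
    simp [this, position]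
  · rw [one_mul]
    refine Finset.prod_congr rfl fun i _ => Finset.prod_congr rfl fun v _ => ?_
    rw [mul_assoc, mul_left_comm]

/-! ### The mild form of the kinetic equation -/

/-- The expected product of `g (exp(position) ξ)` over the particles present at time `t`. -/
def expectedProduct {N : ℕ} (κ : Measure (Fin N → ℝ)) [IsProbabilityMeasure κ] (g : ℝ → ℂ)
    (t ξ : ℝ) : ℂ :=
  ∫ x, leafProduct g (lifetimes x) (displacements x) t ξ ∂treeMeasure κ

/-- The expected product of `g (exp(position) ξ)` over the particles of generation less than `n`
that are present at time `t`. -/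
def expectedProductTrunc {N : ℕ} (κ : Measure (Fin N → ℝ)) [IsProbabilityMeasure κ] (g : ℝ → ℂ)
    (n : ℕ) (t ξ : ℝ) : ℂ :=
  ∫ x, leafProductTrunc g n (lifetimes x) (displacements x) t ξ ∂treeMeasure κ

section

variable {N : ℕ} (κ : Measure (Fin N → ℝ)) [IsProbabilityMeasure κ] {g : ℝ → ℂ}

lemma measurable_expectedProductTrunc (hgm : Measurable g) (n : ℕ) :
    Measurable fun p : ℝ × ℝ => expectedProductTrunc κ g n p.1 p.2 :=
  ((measurable_leafProductTrunc hgm n).stronglyMeasurable.integral_prod_right'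
    (ν := treeMeasure κ)).measurable

lemma aestronglyMeasurable_leafProductTrunc (hgm : Measurable g) (n : ℕ) (t ξ : ℝ) :
    AEStronglyMeasurable
      (fun x => leafProductTrunc g n (lifetimes x) (displacements x) t ξ) (treeMeasure κ) :=
  ((measurable_leafProductTrunc hgm n).comp
    (measurable_prodMk_left (x := (t, ξ)))).aestronglyMeasurable

lemma norm_expectedProductTrunc_le (hg : ∀ ξ, ‖g ξ‖ ≤ 1) (n : ℕ) (t ξ : ℝ) :
    ‖expectedProductTrunc κ g n t ξ‖ ≤ 1 := by
  simpa [expectedProductTrunc] using norm_integral_le_of_norm_le_const (μ := treeMeasure κ)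
    (ae_of_all _ fun x => norm_leafProductTrunc_le hg n (lifetimes x) (displacements x) t ξ)

lemma tendsto_expectedProductTrunc (hgm : Measurable g) (hg : ∀ ξ, ‖g ξ‖ ≤ 1) (t ξ : ℝ) :
    Tendsto (fun n => expectedProductTrunc κ g n t ξ) atTop (𝓝 (expectedProduct κ g t ξ)) := by
  refine tendsto_integral_of_dominated_convergence (fun _ => 1)
    (fun n => aestronglyMeasurable_leafProductTrunc κ hgm n t ξ) (integrable_const 1)
    (fun n => ae_of_all _ fun x => norm_leafProductTrunc_le hg n _ _ t ξ) ?_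
  filter_upwards [ae_finite_alive κ] with x hx
  exact tendsto_const_nhds.congr' <|
    (eventually_leafProductTrunc_eq g (displacements x) ξ (hx t)).mono fun _ h => h.symm

lemma norm_expectedProduct_le (hgm : Measurable g) (hg : ∀ ξ, ‖g ξ‖ ≤ 1) (t ξ : ℝ) :
    ‖expectedProduct κ g t ξ‖ ≤ 1 :=
  le_of_tendsto (tendsto_expectedProductTrunc κ hgm hg t ξ).norm
    (Eventually.of_forall fun n => norm_expectedProductTrunc_le κ hg n t ξ)

lemma measurable_expectedProduct (hgm : Measurable g) (hg : ∀ ξ, ‖g ξ‖ ≤ 1) :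
    Measurable fun p : ℝ × ℝ => expectedProduct κ g p.1 p.2 :=
  measurable_of_tendsto_metrizable (measurable_expectedProductTrunc κ hgm)
    (tendsto_pi_nhds.2 fun p => tendsto_expectedProductTrunc κ hgm hg p.1 p.2)

lemma expectedProductTrunc_succ (hgm : Measurable g) (hg : ∀ ξ, ‖g ξ‖ ≤ 1) (n : ℕ) {t : ℝ}
    (ht : 0 ≤ t) (ξ : ℝ) :
    expectedProductTrunc κ g (n + 1) t ξ = ∫ r, (if t < r.1 then g ξ else
      ∏ i, expectedProductTrunc κ g n (t - r.1) (Real.exp (r.2 i) * ξ))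
        ∂(expMeasure 1).prod κ := by
  have hmeas : Measurable fun x : List (Fin N) → ℝ × (Fin N → ℝ) =>
      leafProductTrunc g (n + 1) (lifetimes x) (displacements x) t ξ :=
    (measurable_leafProductTrunc hgm (n + 1)).comp (measurable_prodMk_left (x := (t, ξ)))
  have hint : Integrable (fun p => leafProductTrunc g (n + 1) (lifetimes (graft p))
      (displacements (graft p)) t ξ)
      (((expMeasure 1).prod κ).prod (Measure.pi fun _ : Fin N => treeMeasure κ)) :=
    Integrable.of_bound (hmeas.comp measurable_graft).aestronglyMeasurable 1
      (ae_of_all _ fun p => norm_leafProductTrunc_le hg _ _ _ _ _)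
  have hpos : ∀ᵐ p ∂((expMeasure 1).prod κ).prod (Measure.pi fun _ : Fin N => treeMeasure κ),
      ∀ v, 0 ≤ lifetimes (graft p) v := by
    have := ae_lifetimes_nonneg κ
    rw [← map_graft_treeMeasure] at this
    exact ae_of_ae_map measurable_graft.aemeasurable this
  rw [expectedProductTrunc]
  conv_lhs => rw [← map_graft_treeMeasure]
  rw [integral_map measurable_graft.aemeasurable hmeas.aestronglyMeasurable, integral_prod _ hint]
  refine integral_congr_ae ?_
  filter_upwards [Measure.ae_ae_of_ae_prod hpos] with r hr
  have h1 : ∀ᵐ y ∂(Measure.pi fun _ : Fin N => treeMeasure κ),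
      leafProductTrunc g (n + 1) (lifetimes (graft (r, y))) (displacements (graft (r, y))) t ξ =
        if t < r.1 then g ξ else ∏ i, leafProductTrunc g n (lifetimes (y i))
          (displacements (y i)) (t - r.1) (Real.exp (r.2 i) * ξ) := by
    filter_upwards [hr] with y hy
    rw [leafProductTrunc_succ g n hy _ ht]
    simp only [lifetimes, displacements, graft_nil, graft_append]
    rfl
  rw [integral_congr_ae h1]
  split_ifs
  · simp
  · exact integral_fintype_prod_eq_prod (fun i x => leafProductTrunc g n (lifetimes x)
      (displacements x) (t - r.1) (Real.exp (r.2 i) * ξ))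

lemma expectedProduct_eq_integral_prod (hgm : Measurable g) (hg : ∀ ξ, ‖g ξ‖ ≤ 1) {t : ℝ}
    (ht : 0 ≤ t) (ξ : ℝ) :
    expectedProduct κ g t ξ = ∫ r, (if t < r.1 then g ξ else
      ∏ i, expectedProduct κ g (t - r.1) (Real.exp (r.2 i) * ξ)) ∂(expMeasure 1).prod κ := by
  refine tendsto_nhds_unique
    ((tendsto_add_atTop_iff_nat 1).2 (tendsto_expectedProductTrunc κ hgm hg t ξ)) ?_
  simp_rw [expectedProductTrunc_succ κ hgm hg _ ht]
  refine tendsto_integral_of_dominated_convergence (fun _ => 1) (fun n => ?_) (integrable_const 1)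
    (fun n => ae_of_all _ fun r => ?_) (ae_of_all _ fun r => ?_)
  · refine (Measurable.ite (measurableSet_lt measurable_const measurable_fst) measurable_const
      ?_).aestronglyMeasurable
    refine Finset.measurable_prod _ fun i _ => ?_
    exact (measurable_expectedProductTrunc κ hgm n).comp
      (g := fun p : ℝ × ℝ => expectedProductTrunc κ g n p.1 p.2)
      (f := fun r : ℝ × (Fin N → ℝ) => (t - r.1, Real.exp (r.2 i) * ξ)) (by fun_prop)
  · split_ifs
    · exact hg ξ
    · rw [norm_prod]
      exact Finset.prod_le_one (fun _ _ => norm_nonneg _)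
        fun i _ => norm_expectedProductTrunc_le κ hg n _ _
  · split_ifs
    · exact tendsto_const_nhds
    · exact tendsto_finsetProd _ fun i _ => tendsto_expectedProductTrunc κ hgm hg _ _

/-- The gain term of the kinetic equation. -/
def gain (g : ℝ → ℂ) (ξ u : ℝ) : ℂ :=
  ∫ d, ∏ i, expectedProduct κ g u (Real.exp (d i) * ξ) ∂κ

lemma measurable_expectedProduct_gain (hgm : Measurable g) (hg : ∀ ξ, ‖g ξ‖ ≤ 1) (ξ : ℝ) :
    Measurable fun p : ℝ × (Fin N → ℝ) =>
      ∏ i, expectedProduct κ g p.1 (Real.exp (p.2 i) * ξ) := by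
  refine Finset.measurable_prod _ fun i _ => ?_
  exact (measurable_expectedProduct κ hgm hg).comp
    (g := fun p : ℝ × ℝ => expectedProduct κ g p.1 p.2)
    (f := fun r : ℝ × (Fin N → ℝ) => (r.1, Real.exp (r.2 i) * ξ)) (by fun_prop)

lemma norm_prod_expectedProduct_le (hgm : Measurable g) (hg : ∀ ξ, ‖g ξ‖ ≤ 1) (ξ u : ℝ)
    (d : Fin N → ℝ) : ‖∏ i, expectedProduct κ g u (Real.exp (d i) * ξ)‖ ≤ 1 := by
  rw [norm_prod]
  exact Finset.prod_le_one (fun _ _ => norm_nonneg _)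
    fun i _ => norm_expectedProduct_le κ hgm hg _ _

lemma measurable_gain (hgm : Measurable g) (hg : ∀ ξ, ‖g ξ‖ ≤ 1) (ξ : ℝ) :
    Measurable (gain κ g ξ) :=
  ((measurable_expectedProduct_gain κ hgm hg ξ).stronglyMeasurable.integral_prod_right'
    (ν := κ)).measurable

lemma norm_gain_le (hgm : Measurable g) (hg : ∀ ξ, ‖g ξ‖ ≤ 1) (ξ u : ℝ) :
    ‖gain κ g ξ u‖ ≤ 1 := by
  simpa [gain] using norm_integral_le_of_norm_le_const (μ := κ)
    (ae_of_all _ fun d => norm_prod_expectedProduct_le κ hgm hg ξ u d)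

lemma intervalIntegrable_exp_mul_gain (hgm : Measurable g) (hg : ∀ ξ, ‖g ξ‖ ≤ 1) (ξ a b : ℝ) :
    IntervalIntegrable (fun u => Real.exp u • gain κ g ξ u) volume a b := by
  refine IntervalIntegrable.continuousOn_smul ?_ Real.continuous_exp.continuousOn
  refine (intervalIntegrable_const (c := (1 : ℝ))).mono_fun
    (measurable_gain κ hgm hg ξ).aestronglyMeasurable (ae_of_all _ fun u => ?_)
  simpa using norm_gain_le κ hgm hg ξ u

/-- Duhamel's formula. -/
lemma expectedProduct_eq (hgm : Measurable g) (hg : ∀ ξ, ‖g ξ‖ ≤ 1) {t : ℝ} (ht : 0 ≤ t) (ξ : ℝ) :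
    expectedProduct κ g t ξ =
      Real.exp (-t) • (g ξ + ∫ u in (0 : ℝ)..t, Real.exp u • gain κ g ξ u) := by
  have hint : Integrable (fun r : ℝ × (Fin N → ℝ) => if t < r.1 then g ξ else
      ∏ i, expectedProduct κ g (t - r.1) (Real.exp (r.2 i) * ξ)) ((expMeasure 1).prod κ) := by
    refine Integrable.of_bound (Measurable.ite (measurableSet_lt measurable_const measurable_fst)
      measurable_const ?_).aestronglyMeasurable 1 (ae_of_all _ fun r => ?_)
    · exact (measurable_expectedProduct_gain κ hgm hg ξ).comp
        (f := fun r : ℝ × (Fin N → ℝ) => (t - r.1, r.2)) (by fun_prop)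
    · split_ifs
      · exact hg ξ
      · exact norm_prod_expectedProduct_le κ hgm hg ξ _ _
  have hin : ∀ s : ℝ, ∫ d, (if t < s then g ξ else
      ∏ i, expectedProduct κ g (t - s) (Real.exp (d i) * ξ)) ∂κ =
      if t < s then g ξ else gain κ g ξ (t - s) := by
    intro s
    split_ifs
    · simp
    · rfl
  have hexp : IntegrableOn (fun s : ℝ => Real.exp (-s)) (Set.Ioi 0) := integrableOn_exp_neg_Ioi 0
  have hint2 : IntegrableOn (fun s => Real.exp (-s) •
      (if t < s then g ξ else gain κ g ξ (t - s))) (Set.Ioi 0) := by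
    refine hexp.mono' ?_ (ae_of_all _ fun s => ?_)
    · have h1 : Measurable fun s => gain κ g ξ (t - s) :=
        (measurable_gain κ hgm hg ξ).comp (by fun_prop)
      have h2 : Measurable fun s => if t < s then g ξ else gain κ g ξ (t - s) :=
        Measurable.ite (measurableSet_lt measurable_const measurable_id) measurable_const h1
      exact ((by fun_prop : Measurable fun s : ℝ => Real.exp (-s)).smul h2).aestronglyMeasurable
    · rw [norm_smul, Real.norm_of_nonneg (Real.exp_pos _).le]
      refine mul_le_of_le_one_right (Real.exp_pos _).le ?_
      split_ifs
      · exact hg ξ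
      · exact norm_gain_le κ hgm hg ξ _
  rw [expectedProduct_eq_integral_prod κ hgm hg ht, integral_prod _ hint]
  simp_rw [hin]
  rw [integral_expMeasure, ← Set.Ioc_union_Ioi_eq_Ioi ht, setIntegral_union
    (Set.Ioc_disjoint_Ioi le_rfl) measurableSet_Ioi
    (hint2.mono_set Set.Ioc_subset_Ioi_self) (hint2.mono_set (Set.Ioi_subset_Ioi ht)),
    ← intervalIntegral.integral_of_le ht, smul_add, add_comm]
  congr 1
  · have : ∀ s ∈ Set.Ioi t, Real.exp (-s) • (if t < s then g ξ else gain κ g ξ (t - s)) =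
        Real.exp (-s) • g ξ := fun s hs => by rw [if_pos (Set.mem_Ioi.1 hs)]
    rw [setIntegral_congr_fun measurableSet_Ioi this, integral_smul_const, integral_exp_neg_Ioi]
  · rw [← intervalIntegral.integral_smul]
    have := intervalIntegral.integral_comp_sub_left (a := 0) (b := t)
      (fun u => Real.exp (-t) • Real.exp u • gain κ g ξ u) t
    simp only [sub_self, sub_zero] at this
    rw [← this]
    refine intervalIntegral.integral_congr fun s hs => ?_
    rw [Set.uIcc_of_le ht] at hs
    simp only [not_lt.2 hs.2, if_false]
    rw [smul_smul, ← Real.exp_add]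
    ring_nf

lemma continuousOn_expectedProduct (hgm : Measurable g) (hg : ∀ ξ, ‖g ξ‖ ≤ 1) (ξ : ℝ) :
    ContinuousOn (fun t => expectedProduct κ g t ξ) (Set.Ici 0) := by
  have : Continuous fun t : ℝ =>
      Real.exp (-t) • (g ξ + ∫ u in (0 : ℝ)..t, Real.exp u • gain κ g ξ u) :=
    (by fun_prop : Continuous fun t : ℝ => Real.exp (-t)).smul (continuous_const.add
      (intervalIntegral.continuous_primitive (intervalIntegrable_exp_mul_gain κ hgm hg ξ) 0))
  exact this.continuousOn.congr fun t ht => expectedProduct_eq κ hgm hg ht ξ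

lemma continuousAt_gain (hgm : Measurable g) (hg : ∀ ξ, ‖g ξ‖ ≤ 1) (ξ : ℝ) {t : ℝ} (ht : 0 < t) :
    ContinuousAt (gain κ g ξ) t := by
  refine tendsto_integral_filter_of_dominated_convergence (fun _ => 1)
    (Eventually.of_forall fun u => ?_)
    (Eventually.of_forall fun u => ae_of_all _ fun d =>
      norm_prod_expectedProduct_le κ hgm hg ξ u d) (integrable_const 1) (ae_of_all _ fun d => ?_)
  · exact ((measurable_expectedProduct_gain κ hgm hg ξ).comp
      (measurable_prodMk_left (x := u))).aestronglyMeasurable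
  · exact tendsto_finsetProd _ fun i _ =>
      (continuousOn_expectedProduct κ hgm hg _).continuousAt (Ici_mem_nhds ht)

lemma hasDerivAt_expectedProduct (hgm : Measurable g) (hg : ∀ ξ, ‖g ξ‖ ≤ 1) (ξ : ℝ) {t : ℝ}
    (ht : 0 < t) :
    HasDerivAt (fun s => expectedProduct κ g s ξ)
      (gain κ g ξ t - expectedProduct κ g t ξ) t := by
  have h1 : HasDerivAt (fun s => ∫ u in (0 : ℝ)..s, Real.exp u • gain κ g ξ u)
      (Real.exp t • gain κ g ξ t) t := by
    refine intervalIntegral.integral_hasDerivAt_right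
      (intervalIntegrable_exp_mul_gain κ hgm hg ξ 0 t) ?_
      (Real.continuous_exp.continuousAt.smul (continuousAt_gain κ hgm hg ξ ht))
    exact (Measurable.smul Real.measurable_exp (measurable_gain κ hgm hg ξ)).stronglyMeasurable
      |>.stronglyMeasurableAtFilter
  have h2 : HasDerivAt (fun s : ℝ => Real.exp (-s)) (-Real.exp (-t)) t := by
    simpa using (hasDerivAt_neg t).exp
  have h3 := h2.smul (h1.const_add (g ξ))
  have h4 : HasDerivAt (fun s => expectedProduct κ g s ξ) _ t :=
    h3.congr_of_eventuallyEq <| by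
      filter_upwards [Ioi_mem_nhds ht] with s hs
      exact expectedProduct_eq κ hgm hg (le_of_lt hs) ξ
  convert! h4 using 1
  rw [expectedProduct_eq κ hgm hg ht.le, smul_smul, ← Real.exp_add, neg_smul]
  simp [sub_eq_add_neg]

lemma expectedProduct_zero (hgm : Measurable g) (hg : ∀ ξ, ‖g ξ‖ ≤ 1) (ξ : ℝ) :
    expectedProduct κ g 0 ξ = g ξ := by
  simp [expectedProduct_eq κ hgm hg le_rfl]

end

/-! ### Uniqueness -/

lemma norm_prod_sub_prod_le {ι : Type*} (s : Finset ι) {a b : ι → ℂ} (ha : ∀ i, ‖a i‖ ≤ 1)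
    (hb : ∀ i, ‖b i‖ ≤ 1) : ‖∏ i ∈ s, a i - ∏ i ∈ s, b i‖ ≤ ∑ i ∈ s, ‖a i - b i‖ := by
  classical
  induction s using Finset.induction_on with
  | empty => simp
  | insert j s hj ih =>
    rw [Finset.prod_insert hj, Finset.prod_insert hj, Finset.sum_insert hj]
    have hs : ‖∏ i ∈ s, a i‖ ≤ 1 := by
      rw [norm_prod]
      exact Finset.prod_le_one (fun _ _ => norm_nonneg _) fun i _ => ha i
    calc ‖a j * ∏ i ∈ s, a i - b j * ∏ i ∈ s, b i‖
        = ‖(a j - b j) * ∏ i ∈ s, a i + b j * (∏ i ∈ s, a i - ∏ i ∈ s, b i)‖ := by ring_nf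
      _ ≤ ‖a j - b j‖ * ‖∏ i ∈ s, a i‖ + ‖b j‖ * ‖∏ i ∈ s, a i - ∏ i ∈ s, b i‖ := by
          refine (norm_add_le _ _).trans ?_
          rw [norm_mul, norm_mul]
      _ ≤ ‖a j - b j‖ + ∑ i ∈ s, ‖a i - b i‖ :=
          add_le_add (mul_le_of_le_one_right (norm_nonneg _) hs)
            ((mul_le_of_le_one_left (norm_nonneg _) (hb j)).trans ih)

section

variable {N : ℕ} {Ω : Type*} [MeasurableSpace Ω] {P : Measure Ω}
  {A : Fin N → Ω → ℝ} {X₀ : Ω → ℝ} {φ ψ : ℝ → ℝ → ℂ}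

lemma norm_smoothingOp_sub_le [IsProbabilityMeasure P] (hA : ∀ i, Measurable (A i))
    {f h : ℝ → ℂ} (hf : Measurable f) (hh : Measurable h) (hf1 : ∀ ξ, ‖f ξ‖ ≤ 1)
    (hh1 : ∀ ξ, ‖h ξ‖ ≤ 1) {C : ℝ} (hC : ∀ ξ, ‖f ξ - h ξ‖ ≤ C) (ξ : ℝ) :
    ‖smoothingOp P A (fun _ => f) ξ - smoothingOp P A (fun _ => h) ξ‖ ≤ N * C := by
  have hint : ∀ {k : ℝ → ℂ}, Measurable k → (∀ ξ, ‖k ξ‖ ≤ 1) →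
      Integrable (fun ω => ∏ i, k (A i ω * ξ)) P := by
    intro k hk hk1
    refine Integrable.of_bound (Finset.measurable_prod _ fun i _ =>
      hk.comp ((hA i).mul_const ξ)).aestronglyMeasurable 1 (ae_of_all _ fun ω => ?_)
    rw [norm_prod]
    exact Finset.prod_le_one (fun _ _ => norm_nonneg _) fun i _ => hk1 _
  rw [smoothingOp, smoothingOp, ← integral_sub (hint hf hf1) (hint hh hh1)]
  have : ∀ ω, ‖∏ i, f (A i ω * ξ) - ∏ i, h (A i ω * ξ)‖ ≤ N * C := fun ω => by
    refine (norm_prod_sub_prod_le _ (fun _ => hf1 _) fun _ => hh1 _).trans ?_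
    simpa using Finset.sum_le_sum fun i (_ : i ∈ Finset.univ) => hC (A i ω * ξ)
  simpa using norm_integral_le_of_norm_le_const (μ := P) (ae_of_all _ this)

lemma IsSolution.norm_le_one (hφ : IsSolution P A X₀ φ) {t : ℝ} (ht : 0 ≤ t) (ξ : ℝ) :
    ‖φ t ξ‖ ≤ 1 := by
  obtain ⟨ρ, _, h⟩ := hφ.charFun_of_prob t ht
  exact h ξ ▸ norm_charFun_le_one ξ

lemma IsSolution.measurable (hφ : IsSolution P A X₀ φ) {t : ℝ} (ht : 0 ≤ t) :
    Measurable (φ t) := by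
  obtain ⟨ρ, _, h⟩ := hφ.charFun_of_prob t ht
  rw [funext h]
  exact measurable_charFun

lemma IsSolution.norm_diff_le [IsProbabilityMeasure P] (hA : ∀ i, Measurable (A i))
    (hφ : IsSolution P A X₀ φ) (hψ : IsSolution P A X₀ ψ) (n : ℕ) {t : ℝ} (ht : 0 ≤ t) (ξ : ℝ) :
    ‖ψ t ξ - φ t ξ‖ ≤ 2 * ((N + 1) * t) ^ n / n.factorial := by
  induction n generalizing t ξ with
  | zero =>
    have := norm_sub_le (ψ t ξ) (φ t ξ)
    have h1 := hφ.norm_le_one ht ξ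
    have h2 := hψ.norm_le_one ht ξ
    simp only [pow_zero, Nat.factorial_zero, Nat.cast_one]
    linarith
  | succ n ih =>
    rcases ht.eq_or_lt with rfl | ht0
    · rw [hφ.initial, hψ.initial]
      simp
    have hcont : ContinuousOn (fun s => ψ s ξ - φ s ξ) (Set.Ici 0) :=
      (hψ.continuous_time ξ).sub (hφ.continuous_time ξ)
    have hlim : Tendsto (fun ε => ‖ψ ε ξ - φ ε ξ‖ +
        2 * ((N + 1) * t) ^ (n + 1) / (n + 1).factorial) (𝓝[>] 0)
        (𝓝 (2 * ((N + 1) * t) ^ (n + 1) / (n + 1).factorial)) := by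
      have h0 := ((hcont 0 Set.self_mem_Ici).mono_left
        (nhdsWithin_mono 0 Set.Ioi_subset_Ici_self)).norm
      simp only [hφ.initial, hψ.initial, sub_self, norm_zero] at h0
      simpa using h0.add_const (2 * ((N + 1) * t) ^ (n + 1) / (n + 1).factorial)
    refine ge_of_tendsto hlim ?_
    filter_upwards [Ioo_mem_nhdsGT ht0] with ε hε
    choose! dφ hdφ heφ using fun s hs => hφ.equation s hs ξ
    choose! dψ hdψ heψ using fun s hs => hψ.equation s hs ξ
    have hpos : ∀ s ∈ Set.Ico ε t, 0 < s := fun s hs => hε.1.trans_le hs.1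
    have hB : ∀ s : ℝ, HasDerivAt (fun s : ℝ => ‖ψ ε ξ - φ ε ξ‖ +
        2 * ((N + 1) * s) ^ (n + 1) / (n + 1).factorial)
        ((N + 1) * (2 * ((N + 1) * s) ^ n / n.factorial)) s := by
      intro s
      have h1 := ((((hasDerivAt_id s).const_mul ((N : ℝ) + 1)).pow (n + 1)).const_mul 2).div_const
        ((n + 1).factorial : ℝ) |>.const_add ‖ψ ε ξ - φ ε ξ‖
      convert! h1 using 1
      have : (n.factorial : ℝ) ≠ 0 := by positivity
      simp only [Nat.factorial_succ, Nat.cast_mul, Nat.cast_succ, id, Nat.add_sub_cancel]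
      field_simp
    refine image_norm_le_of_norm_deriv_right_le_deriv_boundary (a := ε) (b := t)
      (B := fun s : ℝ => ‖ψ ε ξ - φ ε ξ‖ + 2 * ((N + 1) * s) ^ (n + 1) / (n + 1).factorial)
      (f := fun s => ψ s ξ - φ s ξ) (f' := fun s => dψ s - dφ s)
      (hcont.mono fun s hs => hε.1.le.trans hs.1)
      (fun s hs => ((hdψ s (hpos s hs)).sub (hdφ s (hpos s hs))).hasDerivWithinAt)
      (le_add_of_nonneg_right ?_) hB (fun s hs => ?_) ⟨hε.2.le, le_rfl⟩
    · have := hε.1.le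
      positivity
    · have hs := hpos s hs
      set C := 2 * ((N + 1) * s) ^ n / n.factorial
      have h1 := norm_smoothingOp_sub_le (P := P) hA (hψ.measurable hs.le) (hφ.measurable hs.le)
        (hψ.norm_le_one hs.le) (hφ.norm_le_one hs.le) (fun η => ih hs.le η) ξ
      have h2 := ih hs.le ξ
      have h3 : dψ s - dφ s = (smoothingOp P A (fun _ => ψ s) ξ - smoothingOp P A (fun _ => φ s) ξ)
          - (ψ s ξ - φ s ξ) := by
        rw [← heψ s hs, ← heφ s hs]
        ring
      rw [h3]
      refine (norm_sub_le _ _).trans ?_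
      linarith

theorem IsSolution.unique [IsProbabilityMeasure P] (hA : ∀ i, Measurable (A i))
    (hφ : IsSolution P A X₀ φ) (hψ : IsSolution P A X₀ ψ) {t : ℝ} (ht : 0 ≤ t) (ξ : ℝ) :
    ψ t ξ = φ t ξ := by
  have hlim : Tendsto (fun n : ℕ => 2 * ((N + 1) * t) ^ n / n.factorial) atTop (𝓝 (2 * 0)) := by
    simpa only [mul_div_assoc] using
      (FloorSemiring.tendsto_pow_div_factorial_atTop ((N + 1) * t)).const_mul 2
  have := ge_of_tendsto' hlim fun n => hφ.norm_diff_le hA hψ n ht ξ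
  rw [mul_zero, norm_le_zero_iff, sub_eq_zero] at this
  exact this

end

/-! ### Weighted sums of i.i.d. random variables -/

lemma integral_exp_sum_infinitePi {ι : Type*} (ν : Measure ℝ) [IsProbabilityMeasure ν]
    (s : Finset ι) (a : ι → ℝ) (ξ : ℝ) :
    ∫ x, Complex.exp (ξ * ((∑ k ∈ s, a k * x k : ℝ) : ℂ) * Complex.I)
      ∂Measure.infinitePi (fun _ : ι => ν) = ∏ k ∈ s, charFun ν (a k * ξ) := by
  have hind : iIndepFun (fun k (x : ι → ℝ) => a k * x k) (Measure.infinitePi fun _ : ι => ν) :=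
    iIndepFun_infinitePi (X := fun k y => a k * y) fun k => by fun_prop
  have h := congrFun ((hind.restrict s).charFun_map_fun_finsetSum_eq_prod
    (fun k _ => Measurable.aemeasurable (by fun_prop))) ξ
  rw [charFun_apply_real, integral_map (Measurable.aemeasurable (by fun_prop))
    (Measurable.aestronglyMeasurable (by fun_prop)), Finset.prod_apply] at h
  rw [h]
  refine Finset.prod_congr rfl fun k _ => ?_
  rw [← charFun_map_mul]
  conv_rhs => rw [← Measure.infinitePi_map_eval (fun _ : ι => ν) k]
  rw [Measure.map_map (by fun_prop) (by fun_prop)]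
  rfl

section

variable {N : ℕ} (κ : Measure (Fin N → ℝ)) [IsProbabilityMeasure κ]

open Classical in
/-- The expected product of characteristic functions is again a characteristic function. -/
lemma exists_charFun_eq_expectedProduct (ν : Measure ℝ) [IsProbabilityMeasure ν] (t : ℝ) :
    ∃ ρ : Measure ℝ, IsProbabilityMeasure ρ ∧
      ∀ ξ, expectedProduct κ (charFun ν) t ξ = charFun ρ ξ := by
  set π := (treeMeasure κ).prod (Measure.infinitePi fun _ : List (Fin N) => ν)
  set a : (List (Fin N) → ℝ × (Fin N → ℝ)) → List (Fin N) → ℝ := fun x v =>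
    if v ∈ alive (lifetimes x) t then Real.exp (position (displacements x) v) else 0 with ha
  have ham : ∀ v, Measurable fun x => a x v := fun v =>
    Measurable.ite ((measurable_prodMk_left (x := t)) (measurableSet_mem_alive v))
      (measurable_position v).exp measurable_const
  set S : ℕ → (List (Fin N) → ℝ × (Fin N → ℝ)) × (List (Fin N) → ℝ) → ℝ := fun n p =>
    ∑ v ∈ words N n, a p.1 v * p.2 v with hS
  set T : (List (Fin N) → ℝ × (Fin N → ℝ)) × (List (Fin N) → ℝ) → ℝ := fun p =>
    ∑ᶠ v, a p.1 v * p.2 v with hT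
  have hSm : ∀ n, Measurable (S n) := fun n => Finset.measurable_sum _ fun v _ =>
    ((ham v).comp measurable_fst).mul (by fun_prop)
  have hlim : ∀ᵐ p ∂π, Tendsto (fun n => S n p) atTop (𝓝 (T p)) := by
    have : ∀ᵐ p ∂π, ∀ t, (alive (lifetimes p.1) t).Finite :=
      Measure.quasiMeasurePreserving_fst.ae (ae_finite_alive κ)
    filter_upwards [this] with p hp
    obtain ⟨n, hn⟩ := exists_subset_words (hp t)
    refine tendsto_const_nhds.congr' ?_
    filter_upwards [eventually_ge_atTop n] with m hm
    refine finsum_eq_sum_of_support_subset _ fun v hv => hn m hm v ?_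
    by_contra hv'
    exact hv (by simp [ha, hv'])
  have hTm : AEMeasurable T π :=
    aemeasurable_of_tendsto_metrizable_ae atTop (fun n => (hSm n).aemeasurable) hlim
  refine ⟨π.map T, Measure.isProbabilityMeasure_map hTm, fun ξ => ?_⟩
  have hnorm : ∀ y : ℝ, ‖Complex.exp (ξ * y * Complex.I)‖ = 1 := fun y => by
    exact_mod_cast Complex.norm_exp_ofReal_mul_I (ξ * y)
  have hn : ∀ n, ∫ p, Complex.exp (ξ * S n p * Complex.I) ∂π =
      expectedProductTrunc κ (charFun ν) n t ξ := by
    intro n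
    have hm : Measurable fun p => Complex.exp (ξ * S n p * Complex.I) := by
      have := hSm n
      fun_prop
    rw [integral_prod _ (Integrable.of_bound hm.aestronglyMeasurable 1
      (ae_of_all _ fun p => (hnorm _).le)), expectedProductTrunc]
    refine integral_congr_ae (ae_of_all _ fun x => ?_)
    simp only [hS]
    rw [integral_exp_sum_infinitePi, leafProductTrunc]
    refine Finset.prod_congr rfl fun v _ => ?_
    simp only [ha]
    split_ifs <;> simp
  rw [charFun_apply_real, integral_map hTm (Measurable.aestronglyMeasurable (by fun_prop))]
  refine tendsto_nhds_unique (tendsto_expectedProductTrunc κ measurable_charFun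
    (fun ξ => norm_charFun_le_one ξ) t ξ) ?_
  simp_rw [← hn]
  refine tendsto_integral_of_dominated_convergence (fun _ => 1) (fun n => ?_) (integrable_const 1)
    (fun n => ae_of_all _ fun p => (hnorm _).le) ?_
  · have := hSm n
    exact Measurable.aestronglyMeasurable (by fun_prop)
  · filter_upwards [hlim] with p hp
    exact ((by fun_prop : Continuous fun y : ℝ =>
      Complex.exp (ξ * y * Complex.I)).tendsto _).comp hp

/-! ### The stochastic representation -/

lemma aemeasurable_yule (t : ℝ) :
    AEMeasurable (fun x => yule (lifetimes x) t) (treeMeasure κ) := by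
  classical
  refine aemeasurable_of_tendsto_metrizable_ae atTop
    (f := fun n x => ∑ v ∈ words N n, if v ∈ alive (lifetimes x) t then 1 else 0) (fun n => ?_) ?_
  · exact (Finset.measurable_sum _ fun v _ => Measurable.ite
      ((measurable_prodMk_left (x := t)) (measurableSet_mem_alive v))
      measurable_const measurable_const).aemeasurable
  · filter_upwards [ae_finite_alive κ] with x hx
    obtain ⟨n, hn⟩ := exists_subset_words (hx t)
    refine tendsto_const_nhds.congr' ?_
    filter_upwards [eventually_ge_atTop n] with m hm
    rw [yule, Set.ncard_eq_toFinset_card _ (hx t), Finset.sum_boole, Nat.cast_id]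
    congr 1
    ext v
    simpa using hn m hm v

lemma aestronglyMeasurable_leafProduct {g : ℝ → ℂ} (hgm : Measurable g) (t ξ : ℝ) :
    AEStronglyMeasurable
      (fun x => leafProduct g (lifetimes x) (displacements x) t ξ) (treeMeasure κ) := by
  refine aestronglyMeasurable_of_tendsto_ae atTop
    (fun n => aestronglyMeasurable_leafProductTrunc κ hgm n t ξ) ?_
  filter_upwards [ae_finite_alive κ] with x hx
  exact tendsto_const_nhds.congr' <|
    (eventually_leafProductTrunc_eq g (displacements x) ξ (hx t)).mono fun _ h => h.symm

end

lemma leafProduct_eq_prod_range {N : ℕ} (g : ℝ → ℂ) {τ : List (Fin N) → ℝ}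
    {D : List (Fin N) → Fin N → ℝ} {t : ℝ} (ξ : ℝ) (h : (alive τ t).Finite) {n : ℕ} {z : ℕ → ℝ}
    (hw : walk τ D t = ∑ k ∈ Finset.range n, Measure.dirac (z k)) :
    leafProduct g τ D t ξ = ∏ k ∈ Finset.range n, g (Real.exp (z k) * ξ) := by
  classical
  have hms : h.toFinset.val.map (position D) = (Finset.range n).val.map z := by
    ext a
    have h1 := congrArg (fun m : Measure ℝ => m {a}) hw
    simp only [walk] at h1
    rw [Measure.sum_apply _ (measurableSet_singleton a),
      tsum_subtype (alive τ t) (fun v => Measure.dirac (position D v) {a}),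
      tsum_eq_sum (s := h.toFinset)
        (fun v hv => Set.indicator_of_notMem (by simpa using hv) _),
      Measure.finsetSum_apply] at h1
    have h2 : ∑ v ∈ h.toFinset, (alive τ t).indicator
        (fun v => Measure.dirac (position D v) {a}) v =
        ((h.toFinset.filter fun v => a = position D v).card : ENNReal) := by
      rw [← Finset.sum_boole]
      refine Finset.sum_congr rfl fun v hv => ?_
      rw [Set.indicator_of_mem (by simpa using hv),
        Measure.dirac_apply' _ (measurableSet_singleton a)]
      simp [Set.indicator_apply, eq_comm]
    have h3 : ∑ k ∈ Finset.range n, Measure.dirac (z k) {a} =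
        (((Finset.range n).filter fun k => a = z k).card : ENNReal) := by
      rw [← Finset.sum_boole]
      refine Finset.sum_congr rfl fun v hv => ?_
      rw [Measure.dirac_apply' _ (measurableSet_singleton a)]
      simp [Set.indicator_apply, eq_comm]
    rw [h2, h3] at h1
    rw [Multiset.count_map, Multiset.count_map]
    exact_mod_cast h1
  rw [leafProduct_eq_prod g D ξ h]
  have := congrArg (fun m => (m.map fun y => g (Real.exp y * ξ)).prod) hms
  simpa only [Multiset.map_map, Finset.prod_map_val, Function.comp] using this

section

variable {N : ℕ} {κ : Measure (Fin N → ℝ)} {Ω : Type*} [MeasurableSpace Ω]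
  {P : Measure Ω} {τ : List (Fin N) → Ω → ℝ} {D : List (Fin N) → Ω → Fin N → ℝ}
  {z : ℝ → ℕ → Ω → ℝ}

lemma IsBranchingRandomWalk.measurable_marks (h : IsBranchingRandomWalk P κ τ D) :
    Measurable fun ω v => (τ v ω, D v ω) :=
  measurable_pi_lambda _ fun v => (h.measurable_lifetime v).prodMk (h.measurable_displacement v)

lemma IsBranchingRandomWalk.ae_finite_alive [IsProbabilityMeasure κ]
    (h : IsBranchingRandomWalk P κ τ D) :
    ∀ᵐ ω ∂P, ∀ t, (alive (fun v => τ v ω) t).Finite :=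
  ae_of_ae_map h.measurable_marks.aemeasurable (h.map_eq ▸ KineticBRW.ae_finite_alive κ)

lemma IsBranchingRandomWalk.integral_leafProduct [IsProbabilityMeasure κ]
    (h : IsBranchingRandomWalk P κ τ D) {g : ℝ → ℂ} (hgm : Measurable g) (t ξ : ℝ) :
    ∫ ω, leafProduct g (fun v => τ v ω) (fun v => D v ω) t ξ ∂P = expectedProduct κ g t ξ := by
  have hm := aestronglyMeasurable_leafProduct κ hgm t ξ
  rw [expectedProduct]
  rw [← h.map_eq] at hm ⊢
  rw [integral_map h.measurable_marks.aemeasurable hm]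
  rfl

/-- The number of particles present at time `t` together with their listed locations. -/
def configuration (τ : List (Fin N) → Ω → ℝ) (z : ℝ → ℕ → Ω → ℝ) (t : ℝ) (ω : Ω) :
    ℕ × (ℕ → ℝ) :=
  (yule (fun v => τ v ω) t, fun k => z t k ω)

lemma IsBranchingRandomWalk.aemeasurable_configuration [IsProbabilityMeasure κ]
    (h : IsBranchingRandomWalk P κ τ D) (hz : IsLocationList P τ D z) (t : ℝ) :
    AEMeasurable (configuration τ z t) P := by
  have h1 := aemeasurable_yule κ t
  rw [← h.map_eq] at h1
  exact (h1.comp_aemeasurable h.measurable_marks.aemeasurable).prodMk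
    (measurable_pi_lambda _ fun k => hz.measurable_location t k).aemeasurable

/-- The sum `∑_{k < n} exp(z_k) x_k`. -/
def configurationSum (p : (ℕ × (ℕ → ℝ)) × (ℕ → ℝ)) : ℝ :=
  ∑ k ∈ Finset.range p.1.1, Real.exp (p.1.2 k) * p.2 k

lemma measurable_configurationSum : Measurable configurationSum := by
  have : Measurable fun q : ((ℕ → ℝ) × (ℕ → ℝ)) × ℕ =>
      ∑ k ∈ Finset.range q.2, Real.exp (q.1.1 k) * q.1.2 k :=
    measurable_from_prod_countable_left fun n => by
      dsimp only
      fun_prop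
  exact this.comp (f := fun p : (ℕ × (ℕ → ℝ)) × (ℕ → ℝ) => ((p.1.2, p.2), p.1.1)) (by fun_prop)

/-- The characteristic function of `∑_{k < 𝒴_t} exp(z_{k,t}) U_k`. -/
lemma IsBranchingRandomWalk.integral_exp_configurationSum [IsProbabilityMeasure κ]
    [IsProbabilityMeasure P] (h : IsBranchingRandomWalk P κ τ D) (hz : IsLocationList P τ D z)
    (ν : Measure ℝ) [IsProbabilityMeasure ν] {t : ℝ} (ht : 0 ≤ t) (ξ : ℝ) :
    ∫ p, Complex.exp (ξ * configurationSum p * Complex.I)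
      ∂(P.map (configuration τ z t)).prod (Measure.infinitePi fun _ : ℕ => ν) =
      expectedProduct κ (charFun ν) t ξ := by
  have hc := h.aemeasurable_configuration hz t
  have hm : Measurable fun p => Complex.exp (ξ * configurationSum p * Complex.I) := by
    have := measurable_configurationSum
    fun_prop
  have := Measure.isProbabilityMeasure_map hc
  have hint : Integrable (fun p => Complex.exp (ξ * configurationSum p * Complex.I))
      ((P.map (configuration τ z t)).prod (Measure.infinitePi fun _ : ℕ => ν)) :=
    Integrable.of_bound hm.aestronglyMeasurable 1 (ae_of_all _ fun p => le_of_eq <| by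
      exact_mod_cast Complex.norm_exp_ofReal_mul_I (ξ * configurationSum p))
  rw [integral_prod _ hint, integral_map hc
    hm.stronglyMeasurable.integral_prod_right'.aestronglyMeasurable,
    ← h.integral_leafProduct measurable_charFun]
  refine integral_congr_ae ?_
  filter_upwards [h.ae_finite_alive, hz.walk_eq t ht] with ω hfin hw
  rw [leafProduct_eq_prod_range _ ξ (hfin t) (hw (hfin t))]
  exact integral_exp_sum_infinitePi ν (Finset.range (yule (fun v => τ v ω) t))
    (fun k => Real.exp (z t k ω)) ξ

lemma IsBranchingRandomWalk.charFun_smoothingTransform [IsProbabilityMeasure κ]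
    [IsProbabilityMeasure P] (h : IsBranchingRandomWalk P κ τ D) (hz : IsLocationList P τ D z)
    (ν : Measure ℝ) [IsProbabilityMeasure ν] {t : ℝ} (ht : 0 ≤ t) (ξ : ℝ) :
    charFun (smoothingTransform P τ z t ν) ξ = expectedProduct κ (charFun ν) t ξ := by
  have hc := h.aemeasurable_configuration hz t
  have hae : Prod.map (configuration τ z t) (id : (ℕ → ℝ) → ℕ → ℝ)
      =ᵐ[P.prod (Measure.infinitePi fun _ : ℕ => ν)] Prod.map (hc.mk _) id := by
    filter_upwards [Measure.quasiMeasurePreserving_fst.ae hc.ae_eq_mk] with p hp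
    simp [Prod.map, hp]
  have hc' : AEMeasurable (Prod.map (configuration τ z t) (id : (ℕ → ℝ) → ℕ → ℝ))
      (P.prod (Measure.infinitePi fun _ : ℕ => ν)) :=
    ⟨_, hc.measurable_mk.prodMap measurable_id, hae⟩
  have hmap : (P.prod (Measure.infinitePi fun _ : ℕ => ν)).map
      (Prod.map (configuration τ z t) id) =
      (P.map (configuration τ z t)).prod (Measure.infinitePi fun _ : ℕ => ν) := by
    rw [Measure.map_congr hae, ← Measure.map_prod_map _ _ hc.measurable_mk measurable_id,
      Measure.map_id, ← Measure.map_congr hc.ae_eq_mk]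
  have heq : smoothingTransform P τ z t ν =
      ((P.map (configuration τ z t)).prod (Measure.infinitePi fun _ : ℕ => ν)).map
        configurationSum := by
    rw [← hmap, AEMeasurable.map_map_of_aemeasurable
      measurable_configurationSum.aemeasurable hc']
    rfl
  rw [heq, charFun_apply_real, integral_map measurable_configurationSum.aemeasurable
    (Measurable.aestronglyMeasurable (by fun_prop)), h.integral_exp_configurationSum hz ν ht]

lemma IsBranchingRandomWalk.integral_exp_sum [IsProbabilityMeasure κ]
    [IsProbabilityMeasure P] (h : IsBranchingRandomWalk P κ τ D) (hz : IsLocationList P τ D z)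
    (ν : Measure ℝ) [IsProbabilityMeasure ν] {X : ℕ → Ω → ℝ} (hX : IsInitialSample P ν τ z X) {t : ℝ}
    (ht : 0 ≤ t) (ξ : ℝ) :
    ∫ ω, Complex.exp (Complex.I * ξ * ((∑ k ∈ Finset.range (yule (fun v => τ v ω) t),
      Real.exp (z t k ω) * X k ω : ℝ) : ℂ)) ∂P = expectedProduct κ (charFun ν) t ξ := by
  have hc := h.aemeasurable_configuration hz t
  have hXm : Measurable fun ω k => X k ω := measurable_pi_lambda _ hX.measurable_sample
  have hlaw : P.map (fun ω k => X k ω) = Measure.infinitePi fun _ : ℕ => ν := by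
    rw [hX.indep.map_fun_eq_infinitePi_map hX.measurable_sample]
    simp_rw [hX.law]
  have hmap : P.map (fun ω => (configuration τ z t ω, fun k => X k ω)) =
      (P.map (configuration τ z t)).prod (Measure.infinitePi fun _ : ℕ => ν) := by
    rw [← hlaw]
    exact (indepFun_iff_map_prod_eq_prod_map_map hc hXm.aemeasurable).1 (hX.indep_walk t ht)
  have hm : Measurable fun p => Complex.exp (ξ * configurationSum p * Complex.I) := by
    have := measurable_configurationSum
    fun_prop
  rw [← h.integral_exp_configurationSum hz ν ht, ← hmap,
    integral_map (hc.prodMk hXm.aemeasurable) hm.aestronglyMeasurable]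
  refine integral_congr_ae (ae_of_all _ fun ω => ?_)
  simp only [configurationSum, configuration]
  congr 1
  ring

end

/-! ### The solution of the Cauchy problem -/

lemma isSolution_expectedProduct {N : ℕ} {Ω : Type*} [MeasurableSpace Ω] (P : Measure Ω)
    [IsProbabilityMeasure P] {A : Fin N → Ω → ℝ} (hA : ∀ i, Measurable (A i))
    (hApos : ∀ i, ∀ᵐ ω ∂P, 0 < A i ω) {X₀ : Ω → ℝ} (hX₀ : Measurable X₀)
    [IsProbabilityMeasure (P.map fun ω i => Real.log (A i ω))] :
    IsSolution P A X₀
      (expectedProduct (P.map fun ω i => Real.log (A i ω)) (charFun (P.map X₀))) := by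
  have : IsProbabilityMeasure (P.map X₀) := Measure.isProbabilityMeasure_map hX₀.aemeasurable
  have hgm : Measurable (charFun (P.map X₀)) := measurable_charFun
  have hg : ∀ ξ, ‖charFun (P.map X₀) ξ‖ ≤ 1 := fun ξ => norm_charFun_le_one ξ
  refine ⟨fun t _ => exists_charFun_eq_expectedProduct _ _ t, expectedProduct_zero _ hgm hg,
    continuousOn_expectedProduct _ hgm hg,
    fun t ht ξ => ⟨_, hasDerivAt_expectedProduct _ hgm hg ξ ht, ?_⟩⟩
  have hm : Measurable fun d : Fin N → ℝ => ∏ i, expectedProduct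
      (P.map fun ω i => Real.log (A i ω)) (charFun (P.map X₀)) t (Real.exp (d i) * ξ) :=
    (measurable_expectedProduct_gain _ hgm hg ξ).comp (measurable_prodMk_left (x := t))
  rw [sub_add_cancel, gain, integral_map (Measurable.aemeasurable (by fun_prop))
    hm.aestronglyMeasurable, smoothingOp]
  refine integral_congr_ae ?_
  filter_upwards [ae_all_iff.2 hApos] with ω hω
  exact Finset.prod_congr rfl fun i _ => by rw [Real.exp_log (hω i)]

end

end KineticBRW

open MeasureTheory ProbabilityTheory KineticBRW in
theorem proposition2p1 {N : ℕ} (hN : 0 < N)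
    {Ω : Type*} [MeasurableSpace Ω] (P : Measure Ω) [IsProbabilityMeasure P]
    (A : Fin N → Ω → ℝ) (hA : ∀ i, Measurable (A i)) (hApos : ∀ i, ∀ᵐ ω ∂P, 0 < A i ω)
    (X₀ : Ω → ℝ) (hX₀ : Measurable X₀) :
    ∃ φ : ℝ → ℝ → ℂ,
      IsSolution P A X₀ φ ∧
      (∀ ψ : ℝ → ℝ → ℂ, IsSolution P A X₀ ψ → ∀ t : ℝ, 0 ≤ t → ∀ ξ : ℝ, ψ t ξ = φ t ξ) ∧
      ∀ (Ω' : Type*) [MeasurableSpace Ω'] (P' : Measure Ω') [IsProbabilityMeasure P']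
        (τ : List (Fin N) → Ω' → ℝ) (D : List (Fin N) → Ω' → Fin N → ℝ) (z : ℝ → ℕ → Ω' → ℝ),
        IsBranchingRandomWalk P' (P.map fun ω i => Real.log (A i ω)) τ D →
        IsLocationList P' τ D z →
        (∀ X : ℕ → Ω' → ℝ, IsInitialSample P' (P.map X₀) τ z X →
          ∀ t : ℝ, 0 ≤ t → ∀ ξ : ℝ,
            φ t ξ = ∫ ω, Complex.exp (Complex.I * ξ *
              ((∑ k ∈ Finset.range (yule (fun v => τ v ω) t),
                Real.exp (z t k ω) * X k ω : ℝ) : ℂ)) ∂P') ∧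
        (haveI : IsProbabilityMeasure (P.map X₀) :=
            Measure.isProbabilityMeasure_map hX₀.aemeasurable
          ∀ t : ℝ, 0 ≤ t → ∀ ξ : ℝ,
            φ t ξ = charFun (smoothingTransform P' τ z t (P.map X₀)) ξ) := by
  have hκ : IsProbabilityMeasure (P.map fun ω i => Real.log (A i ω)) :=
    Measure.isProbabilityMeasure_map (Measurable.aemeasurable (by fun_prop))
  have hν : IsProbabilityMeasure (P.map X₀) := Measure.isProbabilityMeasure_map hX₀.aemeasurable
  have hsol := isSolution_expectedProduct P hA hApos hX₀
  refine ⟨_, hsol, fun ψ hψ t ht ξ => hsol.unique hA hψ ht ξ, ?_⟩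
  intro Ω' _ P' _ τ D z h hz
  exact ⟨fun X hX t ht ξ => (h.integral_exp_sum hz (P.map X₀) hX ht ξ).symm,
    fun t ht ξ => (h.charFun_smoothingTransform hz (P.map X₀) ht ξ).symm⟩
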